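/- \textbf{Theorem 7 (Maximum depth).} Let $b\ge 2$ and let $\mathbb T_b$ be the infinite tree with a root of degree $1$ in which every non-root vertex $v$ has a parent $v^{(0)}$ and exactly $b$ children $v^{(1)},\dots,v^{(b)}$. A rotor configuration assigns to each non-root vertex $v$ a number $r(v)\in\{0,1,\dots,b\}$, meaning that the rotor at $v$ points to $v^{(r(v))}$. At each step of the rotor walk, if the particle is at a non-root vertex $v$, then the rotor at $v$ is first incremented, cyclically in the order $v^{(0)},v^{(1)},\dots,v^{(b)}$, and then the particle moves to the neighbour to which the rotor now points; from the root the particle moves to the root's only child. Particles are started at the root one after the other. Each one performs a rotor walk, stopped at its first return to the root if there is one (otherwise it escapes to infinity, visiting every vertex only finitely many times), and the next particle starts with the rotor positions left by the previous one. Let $D_n\in\{0,1,2,\dots\}\cup\{\infty\}$ be the maximum (supremum) distance from the root reached by the first $n$ particles. Let the initial configuration $R=(R(v))_{v}$ consist of independent identically distributed random variables with values in $\{0,1,\dots,b\}$ whose common distribution is not concentrated at a single point. Then there are constants $c,C\in(0,\infty)$, depending only on $b$ and the distribution of $R(v)$, such that \begin{itemize} \item[(i)] if $\mathbb E R(v)=b-1$,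 then $\mathbb P\bigl[e^{e^{cn}}<D_n<e^{e^{Cn}}\bigr]\to1$ as $n\to\infty$; \item[(ii)] if $\mathbb E R(v)>b-1$, then $\mathbb P\bigl[n\le D_n<Cn\bigr]\to1$ as $n\to\infty$. \end{itemize} -/

import Mathlib

open Filter Topology MeasureTheory ProbabilityTheory

noncomputable section

namespace RotorWalk

/-- Vertices of the infinite `b`-ary tree whose root has degree one. The root is `none`. A non-root
vertex is `some w`, where the word `w` lists the child labels on the way to it, most recent first:
`some []` is the only child of the root, and `some (k :: w)` is a child of `some w`. -/
abbrev Vertex (b : ℕ) : Type := Option (List (Fin b))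

variable {b : ℕ}

/-- The parent of a non-root vertex. -/
def parent : List (Fin b) → Vertex b
  | [] => none
  | _ :: w => some w

/-- The neighbours of the non-root vertex `w` in cyclic order: number `0` is the parent, and
numbers `1, ..., b` are the children. -/
def nbr (w : List (Fin b)) : Fin (b + 1) → Vertex b :=
  Fin.cases (parent w) (fun k => some (k :: w))

/-- The `b`-ary tree as a graph: the edges join each non-root vertex to its parent. -/
def tree (b : ℕ) : SimpleGraph (Vertex b) :=
  SimpleGraph.fromRel fun x y => ∃ w : List (Fin b), x = some w ∧ y = parent w

/-- The level of a vertex: its graph distance from the root. -/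
def level (v : Vertex b) : ℕ := (tree b).dist none v

/-- A rotor configuration: the rotor at the non-root vertex `w` points to `nbr w (r w)`. -/
abbrev Config (b : ℕ) : Type := List (Fin b) → Fin (b + 1)

/-- The position of the particle together with the current rotors. -/
structure State (b : ℕ) where
  pos : Vertex b
  rotor : Config b

/-- One step of rotor walk. From the root the particle moves to the only child. At a non-root
vertex the rotor is first incremented (cyclically, in `Fin (b + 1)`), and then the particle moves
to the neighbour to which the rotor now points. -/
def step (s : State b) : State b :=
  match s.pos with
  | none => ⟨some [], s.rotor⟩
  | some w => ⟨nbr w (s.rotor w + 1), Function.update s.rotor w (s.rotor w + 1)⟩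

/-- The state after `t` steps of the walk started at the root with rotors `r`. -/
def walk (r : Config b) (t : ℕ) : State b := step^[t] ⟨none, r⟩

/-- The walk started at the root with rotors `r` returns to the root. -/
def Returns (r : Config b) : Prop := ∃ t, 0 < t ∧ (walk r t).pos = none

/-- The time of the first return to the root (used only if there is a return). -/
def returnTime (r : Config b) : ℕ := sInf {t | 0 < t ∧ (walk r t).pos = none}

/-- The particle started at the root with rotors `r` visits `v`, being stopped at its first return
to the root. -/
def Visits (r : Config b) (v : Vertex b) : Prop :=
  ∃ t, (∀ s, 0 < s → s < t → (walk r s).pos ≠ none) ∧ (walk r t).pos = v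

open Classical in
/-- The rotors after one particle has completed its walk. If it returns to the root, these are the
rotors at the time of the return. Otherwise it escapes to infinity and visits every vertex only
finitely many times, and these are the eventual values of the rotors (the last alternative does
not occur). -/
def rotorsAfterOne (r : Config b) : Config b :=
  if Returns r then (walk r (returnTime r)).rotor
  else fun w =>
    if h : ∃ k, ∀ᶠ t in atTop, (walk r t).rotor w = k then h.choose else r w

/-- The rotors after `n` successive particles, with initial rotors `r`. -/
def rotorsAfter (r : Config b) (n : ℕ) : Config b := rotorsAfterOne^[n] r

/-- The maximum distance from the root reached by the first `n` particles, with initial rotors `r`;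
it is `⊤` if one of them escapes to infinity. -/
def maxDepth (r : Config b) (n : ℕ) : ℕ∞ :=
  ⨆ (i : ℕ) (_ : i < n) (v : Vertex b) (_ : Visits (rotorsAfter r i) v), (level v : ℕ∞)

theorem adj_parent (w : List (Fin b)) : (tree b).Adj (parent w) (some w) := by
  rw [tree, SimpleGraph.fromRel_adj]
  refine ⟨?_, Or.inr ⟨w, rfl, rfl⟩⟩
  cases w with
  | nil => simp [parent]
  | cons k u => simp [parent]

theorem level_none : level (none : Vertex b) = 0 := by simp [level]

theorem level_some (w : List (Fin b)) : level (some w) = w.length + 1 := by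
  have up : ∀ u : List (Fin b), ∃ p : (tree b).Walk none (some u), p.length = u.length + 1 := by
    intro u
    induction u with
    | nil => exact ⟨.cons (adj_parent []) .nil, rfl⟩
    | cons k u ih =>
      obtain ⟨p, hp⟩ := ih
      exact ⟨p.concat (adj_parent (k :: u)), (p.length_concat _).trans (by rw [hp]; rfl)⟩
  have low : ∀ (x y : Vertex b) (p : (tree b).Walk x y),
      y.elim 0 (fun u => u.length + 1) ≤ x.elim 0 (fun u => u.length + 1) + p.length := by
    intro x y p
    induction p with
    | nil => simp
    | cons h p ih =>
      rw [tree, SimpleGraph.fromRel_adj] at h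
      rw [SimpleGraph.Walk.length_cons]
      obtain ⟨_, ⟨u, rfl, rfl⟩ | ⟨u, rfl, rfl⟩⟩ := h <;> cases u <;>
        simp [parent] at ih ⊢ <;> omega
  obtain ⟨p, hp⟩ := up w
  obtain ⟨q, hq⟩ := p.reachable.exists_walk_length_eq_dist
  have h1 := SimpleGraph.dist_le p
  have h2 := low _ _ q
  simp only [Option.elim] at h2
  unfold level
  omega

end RotorWalk

end

namespace RotorWalk

/-! Give each edge from a vertex to a child cost 0 if the rotor will try that child before pointing
to the parent again, and cost 1 otherwise; the cost of a vertex is the sum along its path from the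
child of the root. If the zero-cost tree has finite height, a particle visits exactly its vertices,
returns, and leaves all their rotors at 0 (`one_particle`). This lowers every positive cost by one
(`cost_cleared`), so particle number `i`, counted from 0, visits exactly the vertices of cost at
most `i`. The depth reached by `n` particles is thus governed by the vertices of cost less than `n`
(`maxDepth_le`, `lt_maxDepth`), a question about first passage in a branching structure.

For i.i.d. rotors let q_h(n) be the probability that depth `h` contains a vertex of cost below `n`
(`reach`; its complement is `avoid`). Independence of the subtrees (`measureReal_unreached`) gives a
recursion in `h` with linear part m q_h(n) + (b - m) q_h(n-1), where m = b - E R is the mean number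
of free children, and with quadratic corrections.

If m < 1, comparison with y^h X^n for some y < 1 shows that q_{Ln}(n) tends to 0 for a suitable L
(`reach_le_pow_mul_pow`), so the depth is at most linear; it is at least `n` because each edge costs
at most 1.

If m = 1, the quadratic terms balance q(n-1) against q(n)^2, so each extra particle takes roughly a
square root of the probability. The upper bound is `reach_two_pow_mul_le`. For the lower bound,
q_h(1) is at least of order 1/h, and repeated square roots bring it up to a constant when log h is
exponential in `n` (`inv_le_reach_one`, `le_mul_reach`). A fraction of the particles is then spent
on forcing a way to exponentially many independent subtrees (`avoid_add_add_le_pow`), which turns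
the constant into probability tending to 1. -/

/-! ### Costs and the excursion of a single particle -/

/-- The number of steps on the path from `w` to its descendant `u ++ w` that go from a vertex to a
child whose number is at most the current rotor there: a particle entering that vertex returns to
the parent before trying such a child. -/
def cost {b : ℕ} (r : Config b) (w : List (Fin b)) : List (Fin b) → ℕ
  | [] => 0
  | k :: u => cost r w u + if r (u ++ w) ≤ k.castSucc then 0 else 1

theorem cost_append_singleton {b : ℕ} (r : Config b) (w u : List (Fin b)) (k : Fin b) :
    cost r w (u ++ [k]) = (if r w ≤ k.castSucc then 0 else 1) + cost r (k :: w) u := by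
  induction u with
  | nil => simp [cost]
  | cons l u ih => simp only [List.cons_append, cost, ih, List.append_assoc, List.nil_append]; omega

theorem cost_congr {b : ℕ} {r r' : Config b} {w : List (Fin b)}
    (h : ∀ u, r (u ++ w) = r' (u ++ w)) (u : List (Fin b)) : cost r w u = cost r' w u := by
  induction u with
  | nil => rfl
  | cons l u ih => simp only [cost, ih, h]

/-- The vertex `x` is reached from its ancestor `w` at zero cost. -/
def Live {b : ℕ} (r : Config b) (w x : List (Fin b)) : Prop := ∃ u, x = u ++ w ∧ cost r w u = 0

theorem live_self {b : ℕ} (r : Config b) (w : List (Fin b)) : Live r w w := ⟨[], rfl, rfl⟩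

theorem live_iff {b : ℕ} (r : Config b) (w x : List (Fin b)) :
    Live r w x ↔ x = w ∨ ∃ k : Fin b, r w ≤ k.castSucc ∧ Live r (k :: w) x := by
  constructor
  · rintro ⟨u, rfl, hu⟩
    rcases List.eq_nil_or_concat u with rfl | ⟨u, k, rfl⟩
    · exact Or.inl rfl
    · rw [List.concat_eq_append, cost_append_singleton] at hu
      refine Or.inr ⟨k, ?_, u, by simp, by omega⟩
      by_contra hk
      simp [hk] at hu
  · rintro (rfl | ⟨k, hk, u, rfl, hu⟩)
    · exact live_self r _
    · exact ⟨u ++ [k], by simp, by rw [cost_append_singleton, if_pos hk, hu]⟩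

theorem Live.congr {b : ℕ} {r r' : Config b} {w x : List (Fin b)}
    (h : ∀ u, r (u ++ w) = r' (u ++ w)) : Live r w x ↔ Live r' w x := by
  simp only [Live, cost_congr h]

theorem Live.suffix {b : ℕ} {r : Config b} {w x : List (Fin b)} (h : Live r w x) : w <:+ x := by
  obtain ⟨u, rfl, -⟩ := h
  exact List.suffix_append _ _

theorem eq_of_cons_suffix {b : ℕ} {k l : Fin b} {w x : List (Fin b)} (hk : k :: w <:+ x)
    (hl : l :: w <:+ x) : k = l := by
  have := List.suffix_of_suffix_length_le hk hl (by simp)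
  simpa using this.eq_of_length (by simp)

theorem not_cons_suffix_self {b : ℕ} (k : Fin b) (w : List (Fin b)) : ¬ k :: w <:+ w := fun h => by
  simpa using h.length_le

open Classical in
/-- The rotors after an excursion into the live subtree of `w`. -/
noncomputable def clear {b : ℕ} (r : Config b) (w : List (Fin b)) : Config b :=
  fun x => if Live r w x then 0 else r x

/-- From `w`, the walk explores precisely the live subtree of `w`, then moves to the parent of `w`
for the first time, at which point the rotors of the live subtree have been cleared. -/
def Excursion {b : ℕ} (r : Config b) (w : List (Fin b)) (t : ℕ) : Prop :=
  step^[t] ⟨some w, r⟩ = ⟨parent w, clear r w⟩ ∧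
    (∀ s < t, ∃ x, Live r w x ∧ (step^[s] ⟨some w, r⟩).pos = some x) ∧
    ∀ x, Live r w x → ∃ s < t, (step^[s] ⟨some w, r⟩).pos = some x

theorem excursion_of_eq_last {b : ℕ} {r : Config b} {w : List (Fin b)} (h : r w = Fin.last b) :
    Excursion r w 1 := by
  have hl : ∀ x, Live r w x ↔ x = w := fun x => by
    rw [live_iff, or_iff_left]
    rintro ⟨k, hk, -⟩
    rw [h] at hk
    exact absurd hk (not_le.2 (Fin.castSucc_lt_last k))
  refine ⟨?_, fun s hs => ⟨w, live_self r w, ?_⟩, fun x hx => ⟨0, one_pos, ?_⟩⟩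
  · have : clear r w = Function.update r w 0 := by
      ext x
      by_cases hx : x = w <;> simp [clear, hl, hx]
    simp [step, h, this, nbr]
  · obtain rfl : s = 0 := by omega
    rfl
  · rw [(hl x).1 hx]
    rfl

/-- The particle tries child `k`, explores its live subtree, and comes back to `w` with the rotor
advanced by one; what remains is an excursion from `w`. The live set of `w` is the union of the two
live sets explored. -/
theorem Excursion.trans {b : ℕ} {r r₁ : Config b} {w : List (Fin b)} {k : Fin b} {t₁ t₂ : ℕ}
    (hk : r w = k.castSucc) (hr₁ : r₁ = Function.update r w k.succ)
    (h₁ : Excursion r₁ (k :: w) t₁) (h₂ : Excursion (clear r₁ (k :: w)) w t₂) :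
    Excursion r w (t₂ + (t₁ + 1)) := by
  have hlk : ∀ x, Live r₁ (k :: w) x ↔ Live r (k :: w) x := fun x => Live.congr fun u => by
    rw [hr₁, Function.update_of_ne]
    intro h
    exact not_cons_suffix_self k w ⟨u, h⟩
  have hw : clear r₁ (k :: w) w = k.succ := by
    rw [clear, if_neg, hr₁, Function.update_self]
    intro h
    exact not_cons_suffix_self k w h.suffix
  have hl : ∀ l : Fin b, l ≠ k → ∀ x,
      (Live (clear r₁ (k :: w)) (l :: w) x ↔ Live r (l :: w) x) := fun l hl x =>
    Live.congr fun u => by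
      rw [clear, if_neg, hr₁, Function.update_of_ne]
      · intro h
        exact not_cons_suffix_self l w ⟨u, h⟩
      · intro h
        exact hl (eq_of_cons_suffix (List.suffix_append _ _) h.suffix)
  have key : ∀ x, Live r w x ↔ Live r₁ (k :: w) x ∨ Live (clear r₁ (k :: w)) w x := fun x => by
    rw [live_iff r, live_iff (clear _ _), hw, hk, hlk]
    constructor
    · rintro (h | ⟨l, hle, h⟩)
      · exact Or.inr (Or.inl h)
      · by_cases hlk : l = k
        · exact Or.inl (hlk ▸ h)
        · refine Or.inr (Or.inr ⟨l, ?_, (hl l hlk x).2 h⟩)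
          rw [Fin.le_def] at hle ⊢
          have : (l : ℕ) ≠ k := fun h => hlk (Fin.ext h)
          simp only [Fin.val_castSucc, Fin.val_succ] at hle ⊢
          omega
    · rintro (h | h | ⟨l, hle, h⟩)
      · exact Or.inr ⟨k, le_rfl, h⟩
      · exact Or.inl h
      · rw [Fin.le_def] at hle
        simp only [Fin.val_castSucc, Fin.val_succ] at hle
        refine Or.inr ⟨l, ?_, (hl l ?_ x).1 h⟩
        · rw [Fin.le_def]
          simp only [Fin.val_castSucc]
          omega
        · rintro rfl
          omega
  have hstep : step ⟨some w, r⟩ = ⟨some (k :: w), r₁⟩ := by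
    have : r w + 1 = k.succ := by rw [hk, Fin.coeSucc_eq_succ]
    simp [step, this, nbr, hr₁]
  have hmid : ∀ s, step^[s + (t₁ + 1)] ⟨some w, r⟩ = step^[s] ⟨some w, clear r₁ (k :: w)⟩ :=
    fun s => by
      rw [Function.iterate_add_apply, Function.iterate_succ_apply, hstep, h₁.1]
      rfl
  refine ⟨?_, fun s hs => ?_, fun x hx => ?_⟩
  · rw [hmid, h₂.1]
    congr 1
    ext x
    have hne : Live (clear r₁ (k :: w)) w x ∨ Live r₁ (k :: w) x ∨ r₁ x = r x := by
      by_cases hx : x = w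
      · exact Or.inl (hx ▸ live_self _ _)
      · exact Or.inr (Or.inr (by rw [hr₁, Function.update_of_ne hx]))
    by_cases ha : Live r₁ (k :: w) x <;> by_cases hb : Live (clear r₁ (k :: w)) w x
    all_goals
      have e := key x
      simp only [ha, hb, or_true, or_false, true_or, false_or, iff_true, iff_false] at e hne
      unfold clear at hb ⊢
      simp [ha, hb, e]
    rw [hne]
  · rcases s with _ | s
    · exact ⟨w, live_self r w, rfl⟩
    · by_cases hs1 : s < t₁
      · obtain ⟨x, hx, hp⟩ := h₁.2.1 s hs1
        exact ⟨x, (key x).2 (Or.inl hx), by rw [Function.iterate_succ_apply, hstep, hp]⟩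
      · obtain ⟨x, hx, hp⟩ := h₂.2.1 (s - t₁) (by omega)
        refine ⟨x, (key x).2 (Or.inr hx), ?_⟩
        rw [show s + 1 = (s - t₁) + (t₁ + 1) by omega, hmid, hp]
  · rcases (key x).1 hx with h | h
    · obtain ⟨s, hs, hp⟩ := h₁.2.2 x h
      exact ⟨s + 1, by omega, by rw [Function.iterate_succ_apply, hstep, hp]⟩
    · obtain ⟨s, hs, hp⟩ := h₂.2.2 x h
      exact ⟨s + (t₁ + 1), by omega, by rw [hmid, hp]⟩

/-- Double induction: on the height bound for the live subtree and, inside, on the number `b - r w`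
of children that the rotor at `w` has yet to try. -/
theorem exists_excursion {b : ℕ} (h : ℕ) : ∀ (r : Config b) (w : List (Fin b)),
    (∀ u : List (Fin b), u.length = h → ¬ Live r w (u ++ w)) → ∃ t, Excursion r w t := by
  induction h with
  | zero => exact fun r w hw => absurd (live_self r w) (hw [] rfl)
  | succ h ih =>
    suffices H : ∀ (d : ℕ) (r : Config b) (w : List (Fin b)), b - (r w : ℕ) = d →
        (∀ u : List (Fin b), u.length = h + 1 → ¬ Live r w (u ++ w)) → ∃ t, Excursion r w t from
      fun r w hw => H _ r w rfl hw
    intro d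
    induction d with
    | zero =>
      intro r w hd hw
      exact ⟨1, excursion_of_eq_last (Fin.ext (by have := (r w).2; simp; omega))⟩
    | succ d ihd =>
      intro r w hd hw
      have hlt : (r w : ℕ) < b := by omega
      obtain ⟨k, hk⟩ : ∃ k : Fin b, r w = k.castSucc := ⟨⟨r w, hlt⟩, rfl⟩
      have hsub : ∀ (l : Fin b) (r' : Config b), (∀ u, r' (u ++ l :: w) = r (u ++ l :: w)) →
          k ≤ l → ∀ u : List (Fin b), u.length = h → ¬ Live r' (l :: w) (u ++ l :: w) := by
        intro l r' hr' hl u hu hlive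
        rw [Live.congr hr'] at hlive
        refine hw (u ++ [l]) (by simp [hu]) ((live_iff _ _ _).2 (Or.inr ⟨l, ?_, ?_⟩))
        · rw [hk]
          exact hl
        · simpa using hlive
      obtain ⟨t₁, h₁⟩ := ih (Function.update r w k.succ) (k :: w) (hsub k _ (fun u => by
        rw [Function.update_of_ne]
        exact fun h => not_cons_suffix_self k w ⟨u, h⟩) le_rfl)
      have hval : clear (Function.update r w k.succ) (k :: w) w = k.succ := by
        rw [clear, if_neg, Function.update_self]
        exact fun h => not_cons_suffix_self k w h.suffix
      obtain ⟨t₂, h₂⟩ := ihd (clear (Function.update r w k.succ) (k :: w)) w (by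
        rw [hval, Fin.val_succ]
        rw [hk, Fin.val_castSucc] at hd
        omega) (by
        intro u hu hlive
        rw [live_iff, hval] at hlive
        rcases hlive with h0 | ⟨l, hl, hlive⟩
        · have := congrArg List.length h0
          simp [hu] at this
        · obtain ⟨u', hu', -⟩ := id hlive
          have hkl : k < l := by
            rw [Fin.le_def] at hl
            simp only [Fin.val_castSucc, Fin.val_succ] at hl
            exact Fin.lt_def.2 (by omega)
          rw [hu'] at hlive
          refine hsub l _ (fun v => ?_) hkl.le u' ?_ hlive
          · rw [clear, if_neg, Function.update_of_ne]
            · exact fun h => not_cons_suffix_self l w ⟨v, h⟩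
            · exact fun h => hkl.ne (eq_of_cons_suffix h.suffix (List.suffix_append _ _))
          · have := congrArg List.length hu'
            simp [hu] at this
            omega)
      exact ⟨_, h₁.trans hk rfl h₂⟩

theorem one_particle {b : ℕ} {r : Config b} {h : ℕ}
    (hr : ∀ u : List (Fin b), u.length = h → cost r [] u ≠ 0) :
    (∀ w, Visits r (some w) ↔ cost r [] w = 0) ∧
      rotorsAfterOne r = fun w => if cost r [] w = 0 then 0 else r w := by
  have hlive : ∀ w, Live r [] w ↔ cost r [] w = 0 := fun w => by simp [Live]
  obtain ⟨t, ht, hin, hall⟩ := exists_excursion h r [] (fun u hu => by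
    rw [List.append_nil, hlive]
    exact hr u hu)
  -- The initial step from the root shifts time by one relative to the excursion from `[]`.
  have hwalk : ∀ s, walk r (s + 1) = step^[s] ⟨some [], r⟩ := fun s => by
    rw [walk, Function.iterate_succ_apply]
    rfl
  have hne : ∀ s, 0 < s → s < t + 1 → (walk r s).pos ≠ none := fun s h0 hs => by
    obtain ⟨s, rfl⟩ : ∃ s', s = s' + 1 := ⟨s - 1, by omega⟩
    obtain ⟨x, -, hx⟩ := hin s (by omega)
    rw [hwalk, hx]
    exact Option.some_ne_none x
  have hend : walk r (t + 1) = ⟨none, clear r []⟩ := by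
    rw [hwalk, ht]
    rfl
  have hret : Returns r := ⟨t + 1, by omega, by rw [hend]⟩
  have htime : returnTime r = t + 1 := by
    apply le_antisymm
    · exact Nat.sInf_le ⟨by omega, by rw [hend]⟩
    · by_contra hlt
      have hmem : 0 < returnTime r ∧ (walk r (returnTime r)).pos = none := Nat.sInf_mem hret
      exact hne _ hmem.1 (not_le.1 hlt) hmem.2
  constructor
  · intro w
    rw [← hlive]
    constructor
    · rintro ⟨s, hs, hp⟩
      rcases s with _ | s
      · simp [walk] at hp
      · by_cases hst : s < t
        · obtain ⟨x, hx, hp'⟩ := hin s hst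
          rw [hwalk, hp'] at hp
          exact Option.some_injective _ hp ▸ hx
        · rcases (not_lt.1 hst).eq_or_lt with rfl | hlt
          · rw [hend] at hp
            exact absurd hp (by simp)
          · exact absurd (by rw [hend]) (hs (t + 1) (by omega) (by omega))
    · intro hw
      obtain ⟨s, hs, hp⟩ := hall w hw
      exact ⟨s + 1, fun s' h0 h1 => hne s' h0 (by omega), by rw [hwalk, hp]⟩
  · rw [rotorsAfterOne, if_pos hret, htime, hend]
    ext w
    simp [clear, hlive]

/-! ### Successive particles and the maximum depth -/

/-- Costs do not decrease along a path. A rotor at 0 makes every outgoing edge free, so exactly the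
first `i` paid edges, those leaving vertices of cost below `i`, become free. -/
theorem cost_cleared {b : ℕ} (r : Config b) (i : ℕ) (w : List (Fin b)) :
    cost (fun x => if cost r [] x < i then 0 else r x) [] w = cost r [] w - i := by
  induction w with
  | nil => simp [cost]
  | cons k w ih =>
    simp only [cost, List.append_nil, ih]
    by_cases h : cost r [] w < i
    · simp only [h, if_true, Fin.zero_le]
      split_ifs <;> omega
    · simp only [h, if_false]
      omega

theorem rotorsAfter_eq {b : ℕ} {r : Config b} {h n : ℕ}
    (hr : ∀ u : List (Fin b), u.length = h → n ≤ cost r [] u) {i : ℕ} (hi : i ≤ n) :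
    rotorsAfter r i = fun w => if cost r [] w < i then 0 else r w := by
  induction i with
  | zero => simp [rotorsAfter]
  | succ i ih =>
    have hi' := ih (by omega)
    rw [rotorsAfter, Function.iterate_succ_apply', ← rotorsAfter, hi',
      (one_particle (h := h) (fun u hu => by
        rw [cost_cleared]
        have := hr u hu
        omega)).2]
    ext w
    rw [cost_cleared]
    by_cases h1 : cost r [] w < i
    · simp [h1.le, h1.trans (Nat.lt_succ_self i)]
    · by_cases h2 : cost r [] w = i
      · simp [h2]
      · have h3 : ¬ cost r [] w - i = 0 := by omega
        have h4 : ¬ cost r [] w < i + 1 := by omega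
        simp [h1, h3, h4]

theorem visits_rotorsAfter_iff {b : ℕ} {r : Config b} {h n : ℕ}
    (hr : ∀ u : List (Fin b), u.length = h → n ≤ cost r [] u) {i : ℕ} (hi : i < n)
    (w : List (Fin b)) : Visits (rotorsAfter r i) (some w) ↔ cost r [] w ≤ i := by
  rw [rotorsAfter_eq hr hi.le, (one_particle (h := h) (fun u hu => by
        rw [cost_cleared]
        have := hr u hu
        omega)).1, cost_cleared]
  omega

theorem cost_le_cost_append {b : ℕ} (r : Config b) (v u : List (Fin b)) :
    cost r [] u ≤ cost r [] (v ++ u) := by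
  induction v with
  | nil => rfl
  | cons k v ih => exact ih.trans (by simp [cost])

theorem maxDepth_le {b : ℕ} {r : Config b} {h n : ℕ}
    (hr : ∀ u : List (Fin b), u.length = h → n ≤ cost r [] u) : maxDepth r n ≤ h := by
  refine iSup₂_le fun i hi => iSup₂_le fun v hv => ?_
  rcases v with _ | w
  · simp [level_none]
  · rw [level_some]
    rw [visits_rotorsAfter_iff hr hi] at hv
    norm_cast
    by_contra hlt
    -- Ancestors are suffixes: this is the ancestor of `w` given by a word of length `h`, and it
    -- already costs at least `n`.
    have := hr (w.drop (w.length - h)) (by simp; omega)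
    have h2 := cost_le_cost_append r (w.take (w.length - h)) (w.drop (w.length - h))
    rw [List.take_append_drop] at h2
    omega

theorem lt_maxDepth {b : ℕ} {r : Config b} {h n : ℕ}
    (hr : ∀ u : List (Fin b), u.length = h → n ≤ cost r [] u) {w : List (Fin b)}
    (hw : cost r [] w < n) : ((w.length + 1 : ℕ) : ℕ∞) ≤ maxDepth r n := by
  have hi : n - 1 < n := by omega
  have hv : Visits (rotorsAfter r (n - 1)) (some w) :=
    (visits_rotorsAfter_iff hr hi w).2 (by omega)
  rw [← level_some]
  exact le_iSup₂_of_le (n - 1) hi (le_iSup₂_of_le (some w) hv le_rfl)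

theorem cost_le_length {b : ℕ} (r : Config b) (u : List (Fin b)) : cost r [] u ≤ u.length := by
  induction u with
  | nil => rfl
  | cons k u ih =>
    simp only [cost, List.length_cons]
    split_ifs <;> omega

/-! ### The recursion for i.i.d. rotors -/

/-- No descendant of `v` at relative depth `h` has relative cost below `n`. -/
def Unreached {b : ℕ} (r : Config b) (h n : ℕ) (v : List (Fin b)) : Prop :=
  ∀ u : List (Fin b), u.length = h → n ≤ cost r v u

theorem unreached_zero {b : ℕ} (r : Config b) (n : ℕ) (v : List (Fin b)) :
    Unreached r 0 n v ↔ n = 0 := by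
  simp [Unreached, cost]

theorem unreached_succ {b : ℕ} (r : Config b) (h n : ℕ) (v : List (Fin b)) :
    Unreached r (h + 1) n v ↔
      ∀ k : Fin b, Unreached r h (if r v ≤ k.castSucc then n else n - 1) (k :: v) := by
  constructor
  · intro H k u hu
    have := H (u ++ [k]) (by simp [hu])
    rw [cost_append_singleton] at this
    split_ifs at this ⊢ <;> omega
  · intro H u hu
    rcases List.eq_nil_or_concat u with rfl | ⟨u, k, rfl⟩
    · simp at hu
    · rw [List.concat_eq_append] at hu ⊢
      have := H k u (by simpa using hu)
      rw [cost_append_singleton]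
      split_ifs at this ⊢ <;> omega

/-- The probability that no vertex at depth `h` has cost below `n`, when the rotors are independent
and take the value `j` with probability `ρ j`. -/
def avoid {b : ℕ} (ρ : Fin (b + 1) → ℝ) : ℕ → ℕ → ℝ
  | 0, n => if n = 0 then 1 else 0
  | h + 1, n => ∑ j, ρ j * (avoid ρ h n ^ (b - (j : ℕ)) * avoid ρ h (n - 1) ^ (j : ℕ))

theorem measure_biInter_eq_prod_of_disjoint {Ω ι κ : Type*} [mΩ : MeasurableSpace Ω]
    {P : Measure Ω} [IsProbabilityMeasure P] {m : ι → MeasurableSpace Ω} (hle : ∀ i, m i ≤ mΩ)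
    (hm : iIndep m P) (S : κ → Set ι) (hS : Pairwise fun k l => Disjoint (S k) (S l))
    (E : κ → Set Ω) (hE : ∀ k, MeasurableSet[⨆ i ∈ S k, m i] (E k)) (s : Finset κ) :
    P (⋂ k ∈ s, E k) = ∏ k ∈ s, P (E k) := by
  classical
  induction s using Finset.induction_on with
  | empty => simp
  | insert k s hk ih =>
    rw [Finset.prod_insert hk, Finset.set_biInter_insert, ← ih]
    have hdisj : Disjoint (S k) (⋃ l ∈ s, S l) := by
      rw [Set.disjoint_iUnion₂_right]
      intro l hl
      exact hS (fun h => hk (h ▸ hl))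
    refine (Indep_iff _ _ _).1 (indep_iSup_of_disjoint hle hm hdisj) _ _ (hE k) ?_
    refine Finset.measurableSet_biInter _ fun l hl => ?_
    refine (iSup_le fun i => iSup_le fun hi => ?_ : ⨆ i ∈ S l, m i ≤ _) _ (hE l)
    exact le_iSup₂_of_le (f := fun i (_ : i ∈ ⋃ l ∈ s, S l) => m i) i
      (Set.mem_biUnion (x := l) hl hi) le_rfl

/-- Measurability with respect to the rotors below `v` only is what makes the events of sibling
subtrees independent. -/
theorem measurableSet_unreached {b : ℕ} {Ω : Type*} (R : List (Fin b) → Ω → Fin (b + 1))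
    (h : ℕ) : ∀ (n : ℕ) (v : List (Fin b)),
      MeasurableSet[⨆ w ∈ {w | v <:+ w}, MeasurableSpace.comap (R w) inferInstance]
        {ω | Unreached (fun w => R w ω) h n v} := by
  induction h with
  | zero =>
    intro n v
    simp only [unreached_zero]
    exact MeasurableSet.const _
  | succ h ih =>
    intro n v
    have : {ω | Unreached (fun w => R w ω) (h + 1) n v} = ⋂ k : Fin b,
        ({ω | R v ω ≤ k.castSucc} ∩ {ω | Unreached (fun w => R w ω) h n (k :: v)}) ∪
        ({ω | R v ω ≤ k.castSucc}ᶜ ∩ {ω | Unreached (fun w => R w ω) h (n - 1) (k :: v)}) := by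
      ext ω
      simp only [unreached_succ, Set.mem_ofPred_eq, Set.mem_iInter, Set.mem_union, Set.mem_inter_iff,
        Set.mem_compl_iff]
      refine forall_congr' fun k => ?_
      split_ifs with hk <;> simp [hk]
    rw [this]
    have hv : ∀ k : Fin b,
        MeasurableSet[⨆ w ∈ {w | v <:+ w}, MeasurableSpace.comap (R w) inferInstance]
          {ω | R v ω ≤ k.castSucc} := fun k =>
      (le_iSup₂_of_le (f := fun w (_ : w ∈ {w | v <:+ w}) =>
        MeasurableSpace.comap (R w) inferInstance) v (List.suffix_refl v) le_rfl) _
        ⟨Set.Iic k.castSucc, MeasurableSet.of_discrete, rfl⟩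
    have hsub : ∀ k : Fin b,
        (⨆ w ∈ {w | k :: v <:+ w}, MeasurableSpace.comap (R w) inferInstance) ≤
          ⨆ w ∈ {w | v <:+ w}, MeasurableSpace.comap (R w) inferInstance := fun k =>
      biSup_mono fun w hw => (List.suffix_cons k v).trans hw
    exact MeasurableSet.iInter fun k => ((hv k).inter (hsub k _ (ih _ _))).union
      ((hv k).compl.inter (hsub k _ (ih _ _)))

theorem prod_ite_le_castSucc {b : ℕ} (j : Fin (b + 1)) (x y : ℝ) :
    ∏ k : Fin b, (if j ≤ k.castSucc then x else y) = x ^ (b - (j : ℕ)) * y ^ (j : ℕ) := by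
  have hj : (j : ℕ) ≤ b := by omega
  have h : ∀ k : Fin b, (if j ≤ k.castSucc then x else y) =
      (fun i : ℕ => if (j : ℕ) ≤ i then x else y) k := fun k => by
    simp [Fin.le_def]
  rw [Finset.prod_congr rfl fun k _ => h k,
    Fin.prod_univ_eq_prod_range (fun i : ℕ => if (j : ℕ) ≤ i then x else y) b]
  rw [← Finset.prod_range_mul_prod_Ico _ hj, mul_comm]
  congr 1
  · rw [Finset.prod_congr rfl (g := fun _ => x)]
    · simp
    · intro i hi
      simp [(Finset.mem_Ico.1 hi).1]
  · rw [Finset.prod_congr rfl (g := fun _ => y)]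
    · simp
    · intro i hi
      simp [Finset.mem_range.1 hi]

/-- Split according to the value `j` of the rotor at `v`. The subtrees of the `b` children and the
rotor itself involve disjoint sets of rotors; `b - j` children are free and keep the budget `n`, the
other `j` have `n - 1`. -/
theorem measureReal_unreached {b : ℕ} {Ω : Type*} [MeasurableSpace Ω] {P : Measure Ω}
    [IsProbabilityMeasure P] {R : List (Fin b) → Ω → Fin (b + 1)} (hR : ∀ v, Measurable (R v))
    (hind : iIndepFun R P) {μ : Measure (Fin (b + 1))} (hμ : ∀ v, P.map (R v) = μ) (h : ℕ) :
    ∀ (n : ℕ) (v : List (Fin b)), P.real {ω | Unreached (fun w => R w ω) h n v} =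
      avoid (fun j => μ.real {j}) h n := by
  have hle : ∀ v, MeasurableSpace.comap (R v) inferInstance ≤ ‹MeasurableSpace Ω› :=
    fun v => (hR v).comap_le
  induction h with
  | zero =>
    intro n v
    by_cases hn : n = 0 <;> simp [unreached_zero, avoid, hn]
  | succ h ih =>
    intro n v
    -- The index `none` stands for the rotor at `v`, and `some k` for the subtree of child `k`.
    let E : Fin (b + 1) → Option (Fin b) → Set Ω := fun j o => o.elim {ω | R v ω = j}
      fun k => {ω | Unreached (fun w => R w ω) h (if j ≤ k.castSucc then n else n - 1) (k :: v)}
    let S : Option (Fin b) → Set (List (Fin b)) := fun o => o.elim {v} fun k => {w | k :: v <:+ w}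
    have hS : Pairwise fun k l => Disjoint (S k) (S l) := by
      rintro (_ | k) (_ | l) hkl
      · exact absurd rfl hkl
      · exact Set.disjoint_singleton_left.2 (not_cons_suffix_self l v)
      · exact Set.disjoint_singleton_right.2 (not_cons_suffix_self k v)
      · refine Set.disjoint_left.2 fun w hk hl => hkl ?_
        rw [eq_of_cons_suffix hk hl]
    have hE : ∀ j k,
        MeasurableSet[⨆ w ∈ S k, MeasurableSpace.comap (R w) inferInstance] (E j k) := by
      rintro j (_ | k)
      · exact (le_iSup₂_of_le (f := fun w (_ : w ∈ ({v} : Set (List (Fin b)))) =>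
          MeasurableSpace.comap (R w) inferInstance) v rfl le_rfl) _
          ⟨{j}, MeasurableSet.of_discrete, rfl⟩
      · exact measurableSet_unreached R h _ (k :: v)
    have hEm : ∀ j k, MeasurableSet (E j k) := fun j k =>
      (iSup₂_le fun w _ => hle w : (⨆ w ∈ S k, MeasurableSpace.comap (R w) inferInstance) ≤ _) _
        (hE j k)
    have hunion : {ω | Unreached (fun w => R w ω) (h + 1) n v} =
        ⋃ j, ⋂ k ∈ (Finset.univ : Finset (Option (Fin b))), E j k := by
      ext ω
      simp only [unreached_succ, Set.mem_ofPred_eq, Finset.mem_univ, Set.iInter_true, Set.mem_iUnion,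
        Set.mem_iInter, Option.forall]
      constructor
      · exact fun H => ⟨R v ω, rfl, H⟩
      · rintro ⟨j, hj, H⟩
        obtain rfl : R v ω = j := hj
        exact H
    rw [hunion, measureReal_iUnion_fintype, avoid]
    · refine Finset.sum_congr rfl fun j _ => ?_
      rw [measureReal_def, measure_biInter_eq_prod_of_disjoint hle hind S hS (E j) (hE j),
        ENNReal.toReal_prod, Fintype.prod_option, ← prod_ite_le_castSucc]
      congr 1
      · change P.real (R v ⁻¹' {j}) = _
        rw [← hμ v, map_measureReal_apply (hR v) MeasurableSet.of_discrete]
      · refine Finset.prod_congr rfl fun k _ => ?_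
        change P.real _ = _
        simp only [E, Option.elim, ih]
        split_ifs <;> rfl
    · intro i j hij
      refine Set.disjoint_left.2 fun ω hi hj => hij ?_
      have hi' : R v ω = i := Set.mem_iInter₂.1 hi none (Finset.mem_univ _)
      have hj' : R v ω = j := Set.mem_iInter₂.1 hj none (Finset.mem_univ _)
      exact hi'.symm.trans hj'
    · exact fun j => Finset.measurableSet_biInter _ fun k _ => hEm j k

/-! ### Monotonicity and amplification -/

theorem avoid_zero_right {b : ℕ} {ρ : Fin (b + 1) → ℝ} (hs : ∑ j, ρ j = 1) (h : ℕ) :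
    avoid ρ h 0 = 1 := by
  induction h with
  | zero => simp [avoid]
  | succ h ih => simp [avoid, ih, hs]

theorem avoid_mem_Icc {b : ℕ} {ρ : Fin (b + 1) → ℝ} (h0 : ∀ j, 0 ≤ ρ j) (hs : ∑ j, ρ j = 1)
    (h n : ℕ) : avoid ρ h n ∈ Set.Icc (0 : ℝ) 1 := by
  induction h generalizing n with
  | zero =>
    by_cases hn : n = 0 <;> simp [avoid, hn]
  | succ h ih =>
    have hterm : ∀ j : Fin (b + 1), avoid ρ h n ^ (b - (j : ℕ)) * avoid ρ h (n - 1) ^ (j : ℕ) ≤ 1 :=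
      fun j => mul_le_one₀ (pow_le_one₀ (ih n).1 (ih n).2) (pow_nonneg (ih _).1 _)
        (pow_le_one₀ (ih _).1 (ih _).2)
    refine ⟨Finset.sum_nonneg fun j _ => mul_nonneg (h0 j)
      (mul_nonneg (pow_nonneg (ih n).1 _) (pow_nonneg (ih _).1 _)), ?_⟩
    rw [← hs]
    exact Finset.sum_le_sum fun j _ => mul_le_of_le_one_right (h0 j) (hterm j)

theorem avoid_succ_mono {b : ℕ} {ρ : Fin (b + 1) → ℝ} (h0 : ∀ j, 0 ≤ ρ j) (hs : ∑ j, ρ j = 1)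
    {h h' n n' : ℕ} (h1 : avoid ρ h n ≤ avoid ρ h' n')
    (h2 : avoid ρ h (n - 1) ≤ avoid ρ h' (n' - 1)) : avoid ρ (h + 1) n ≤ avoid ρ (h' + 1) n' := by
  refine Finset.sum_le_sum fun j _ => mul_le_mul_of_nonneg_left ?_ (h0 j)
  exact mul_le_mul (pow_le_pow_left₀ (avoid_mem_Icc h0 hs _ _).1 h1 _)
    (pow_le_pow_left₀ (avoid_mem_Icc h0 hs _ _).1 h2 _)
    (pow_nonneg (avoid_mem_Icc h0 hs _ _).1 _) (pow_nonneg (avoid_mem_Icc h0 hs _ _).1 _)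

theorem avoid_antitone {b : ℕ} {ρ : Fin (b + 1) → ℝ} (h0 : ∀ j, 0 ≤ ρ j) (hs : ∑ j, ρ j = 1)
    (h : ℕ) : Antitone (avoid ρ h) := by
  refine antitone_nat_of_succ_le fun n => ?_
  induction h generalizing n with
  | zero => cases n <;> simp [avoid]
  | succ h ih =>
    refine avoid_succ_mono h0 hs (ih n) ?_
    cases n with
    | zero => exact le_rfl
    | succ n => exact ih n

theorem avoid_monotone {b : ℕ} {ρ : Fin (b + 1) → ℝ} (h0 : ∀ j, 0 ≤ ρ j) (hs : ∑ j, ρ j = 1)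
    (n : ℕ) : Monotone fun h => avoid ρ h n := by
  refine monotone_nat_of_le_succ fun h => ?_
  induction h generalizing n with
  | zero =>
    cases n with
    | zero => rw [avoid_zero_right hs, avoid_zero_right hs]
    | succ n => simpa [avoid] using (avoid_mem_Icc h0 hs 1 (n + 1)).1
  | succ h ih => exact avoid_succ_mono h0 hs (ih n) (ih (n - 1))

/-- One more unit of budget pays for any edge out of the top vertex, so all `b` subtrees get at
least the budget `n`, independently. -/
theorem avoid_succ_succ_le_pow {b : ℕ} {ρ : Fin (b + 1) → ℝ} (h0 : ∀ j, 0 ≤ ρ j)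
    (hs : ∑ j, ρ j = 1) (h n : ℕ) : avoid ρ (h + 1) (n + 1) ≤ avoid ρ h n ^ b := by
  calc avoid ρ (h + 1) (n + 1)
      ≤ ∑ j, ρ j * avoid ρ h n ^ b := by
        refine Finset.sum_le_sum fun j _ => mul_le_mul_of_nonneg_left ?_ (h0 j)
        have hj : b - (j : ℕ) + j = b := by omega
        calc _ ≤ avoid ρ h n ^ (b - (j : ℕ)) * avoid ρ h n ^ (j : ℕ) :=
              mul_le_mul_of_nonneg_right (pow_le_pow_left₀ (avoid_mem_Icc h0 hs _ _).1
                (avoid_antitone h0 hs h n.le_succ) _) (pow_nonneg (avoid_mem_Icc h0 hs _ _).1 _)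
          _ = avoid ρ h n ^ b := by rw [← pow_add, hj]
    _ = avoid ρ h n ^ b := by rw [← Finset.sum_mul, hs, one_mul]

theorem avoid_add_add_le_pow {b : ℕ} {ρ : Fin (b + 1) → ℝ} (h0 : ∀ j, 0 ≤ ρ j)
    (hs : ∑ j, ρ j = 1) (h n j : ℕ) : avoid ρ (h + j) (n + j) ≤ avoid ρ h n ^ b ^ j := by
  induction j with
  | zero => simp
  | succ j ih =>
    calc _ ≤ avoid ρ (h + j) (n + j) ^ b := avoid_succ_succ_le_pow h0 hs _ _
      _ ≤ (avoid ρ h n ^ b ^ j) ^ b := pow_le_pow_left₀ (avoid_mem_Icc h0 hs _ _).1 ih _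
      _ = avoid ρ h n ^ b ^ (j + 1) := by rw [← pow_mul, pow_succ]

/-! ### Linear and quadratic bounds for the recursion -/

theorem one_sub_mul_add_sq_le_pow {q : ℝ} (h1 : q ≤ 1) (k : ℕ) :
    1 - k * q + (if 2 ≤ k then 1 else 0) * q ^ 2 ≤ (1 - q) ^ k := by
  rcases lt_or_ge k 2 with hk | hk
  · interval_cases k <;> norm_num
  · induction k, hk using Nat.le_induction with
    | base => norm_num; nlinarith
    | succ k hk ih =>
      rw [if_pos hk] at ih
      rw [if_pos (by omega), pow_succ (1 - q)]
      have hk' : (2 : ℝ) ≤ k := by exact_mod_cast hk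
      have h2 := mul_le_mul_of_nonneg_right ih (sub_nonneg.2 h1)
      push_cast
      nlinarith [mul_nonneg (sq_nonneg q) (sub_nonneg.2 h1), mul_nonneg (sub_nonneg.2 hk') (sq_nonneg q)]

/-- The gain `q ^ 2` survives only with at least two free children; it drives the decay in the
critical case. The coefficient of `p` is crudely `b`, which suffices. -/
theorem one_sub_pow_mul_pow_le {p q : ℝ} (hq0 : 0 ≤ q) (hq1 : q ≤ 1) (hp0 : 0 ≤ p) (hp1 : p ≤ 1)
    {b j : ℕ} (hj : j ≤ b) :
    1 - (1 - q) ^ (b - j) * (1 - p) ^ j ≤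
      (b - j) * q + b * p - (if j + 2 ≤ b then 1 else 0) * q ^ 2 := by
  have h1 := one_sub_mul_add_sq_le_pow hq1 (b - j)
  have h2 : 1 - b * p ≤ (1 - p) ^ j := by
    have := one_add_mul_le_pow (a := -p) (by linarith) j
    have hj' : (j : ℝ) * p ≤ b * p := mul_le_mul_of_nonneg_right (by exact_mod_cast hj) hp0
    rw [← sub_eq_add_neg] at this
    linarith
  have h3 : (1 - q) ^ (b - j) ≤ 1 := pow_le_one₀ (by linarith) (by linarith)
  have h4 : 0 ≤ (1 - q) ^ (b - j) := pow_nonneg (by linarith) _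
  have hif : (if j + 2 ≤ b then (1 : ℝ) else 0) = if 2 ≤ b - j then 1 else 0 :=
    if_congr (by omega) rfl rfl
  rw [hif, ← Nat.cast_sub hj]
  have hbp : 0 ≤ b * p := by positivity
  nlinarith [mul_le_mul_of_nonneg_left h2 h4]

/-- The product is at most `exp (-S)` for the linear part `S`, and `exp (-S) ≤ 1 - S + S ^ 2`. -/
theorem pow_mul_pow_le_one_sub {p q : ℝ} (hq1 : q ≤ 1) (hp0 : 0 ≤ p) (hpq : p ≤ q)
    {b j : ℕ} (hj : j ≤ b) :
    (b - j) * q + j * p - b ^ 2 * q ^ 2 ≤ 1 - (1 - q) ^ (b - j) * (1 - p) ^ j := by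
  set S : ℝ := (b - j) * q + j * p with hS
  have hj' : (j : ℝ) ≤ b := by exact_mod_cast hj
  have hS0 : 0 ≤ S := add_nonneg (mul_nonneg (by linarith) (by linarith)) (by positivity)
  have hSb : S ≤ b * q := by
    nlinarith [mul_le_mul_of_nonneg_left hpq (Nat.cast_nonneg (α := ℝ) j)]
  have hprod : (1 - q) ^ (b - j) * (1 - p) ^ j ≤ Real.exp (-S) := by
    have hq' : (1 - q) ^ (b - j) ≤ Real.exp (-q) ^ (b - j) :=
      pow_le_pow_left₀ (by linarith) (Real.one_sub_le_exp_neg q) _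
    have hp' : (1 - p) ^ j ≤ Real.exp (-p) ^ j :=
      pow_le_pow_left₀ (by linarith) (Real.one_sub_le_exp_neg p) _
    refine (mul_le_mul hq' hp' (pow_nonneg (by linarith) _) (by positivity)).trans_eq ?_
    rw [← Real.exp_nat_mul, ← Real.exp_nat_mul, ← Real.exp_add, Nat.cast_sub hj]
    congr 1
    rw [hS]
    ring
  have hexp : Real.exp (-S) ≤ 1 - S + S ^ 2 := by
    rcases le_total S 1 with h | h
    · have := (abs_le.1 (Real.abs_exp_sub_one_sub_id_le (x := -S)
        (by rw [abs_neg, abs_of_nonneg hS0]; exact h))).2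
      nlinarith
    · have : Real.exp (-S) ≤ 1 := Real.exp_le_one_iff.2 (by linarith)
      nlinarith
  have hsq : S ^ 2 ≤ b ^ 2 * q ^ 2 := by
    rw [← mul_pow]
    exact pow_le_pow_left₀ hS0 hSb 2
  linarith

theorem one_sub_avoid_succ {b : ℕ} {ρ : Fin (b + 1) → ℝ} (hs : ∑ j, ρ j = 1) (h n : ℕ) :
    1 - avoid ρ (h + 1) n = ∑ j, ρ j * (1 - (1 - (1 - avoid ρ h n)) ^ (b - (j : ℕ)) *
      (1 - (1 - avoid ρ h (n - 1))) ^ (j : ℕ)) := by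
  simp only [sub_sub_cancel, mul_sub, mul_one, Finset.sum_sub_distrib, hs]
  rfl

theorem one_sub_avoid_succ_le {b : ℕ} {ρ : Fin (b + 1) → ℝ} (h0 : ∀ j, 0 ≤ ρ j)
    (hs : ∑ j, ρ j = 1) (h n : ℕ) :
    1 - avoid ρ (h + 1) n ≤ (b - ∑ j, ρ j * (j : ℕ)) * (1 - avoid ρ h n) +
      b * (1 - avoid ρ h (n - 1)) -
      (∑ j : Fin (b + 1), ρ j * if (j : ℕ) + 2 ≤ b then 1 else 0) * (1 - avoid ρ h n) ^ 2 := by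
  have hq := avoid_mem_Icc h0 hs h n
  have hp := avoid_mem_Icc h0 hs h (n - 1)
  rw [one_sub_avoid_succ hs]
  set q := 1 - avoid ρ h n with hq_def
  set p := 1 - avoid ρ h (n - 1) with hp_def
  calc _ ≤ ∑ j : Fin (b + 1), (b * q * ρ j - ρ j * (j : ℕ) * q + b * p * ρ j -
          (ρ j * if (j : ℕ) + 2 ≤ b then 1 else 0) * q ^ 2) := by
        refine Finset.sum_le_sum fun j _ => ?_
        have := mul_le_mul_of_nonneg_left (one_sub_pow_mul_pow_le (p := p) (q := q)
          (by linarith [hq.2]) (by linarith [hq.1]) (by linarith [hp.2]) (by linarith [hp.1])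
          (Nat.lt_succ_iff.1 j.2)) (h0 j)
        exact this.trans_eq (by ring)
    _ = _ := by
      simp only [Finset.sum_sub_distrib, Finset.sum_add_distrib, ← Finset.mul_sum,
        ← Finset.sum_mul, hs]
      ring

theorem le_one_sub_avoid_succ {b : ℕ} {ρ : Fin (b + 1) → ℝ} (h0 : ∀ j, 0 ≤ ρ j)
    (hs : ∑ j, ρ j = 1) (h n : ℕ) :
    (b - ∑ j, ρ j * (j : ℕ)) * (1 - avoid ρ h n) +
      (∑ j, ρ j * (j : ℕ)) * (1 - avoid ρ h (n - 1)) - b ^ 2 * (1 - avoid ρ h n) ^ 2 ≤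
      1 - avoid ρ (h + 1) n := by
  have hq := avoid_mem_Icc h0 hs h n
  have hp := avoid_mem_Icc h0 hs h (n - 1)
  have hpq := avoid_antitone h0 hs h (Nat.sub_le n 1)
  rw [one_sub_avoid_succ hs]
  set q := 1 - avoid ρ h n with hq_def
  set p := 1 - avoid ρ h (n - 1) with hp_def
  calc _ = ∑ j : Fin (b + 1), (b * q * ρ j - ρ j * (j : ℕ) * q + ρ j * (j : ℕ) * p -
          b ^ 2 * q ^ 2 * ρ j) := by
        simp only [Finset.sum_sub_distrib, Finset.sum_add_distrib, ← Finset.mul_sum,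
          ← Finset.sum_mul, hs]
        ring
    _ ≤ _ := by
        refine Finset.sum_le_sum fun j _ => ?_
        have := mul_le_mul_of_nonneg_left (pow_mul_pow_le_one_sub (p := p) (q := q)
          (by linarith [hq.1]) (by linarith [hp.2]) (by linarith)
          (Nat.lt_succ_iff.1 j.2)) (h0 j)
        exact le_of_eq_of_le (by ring) this

/-- The probability that some vertex at depth `h` has cost below `n`. -/
def reach {b : ℕ} (ρ : Fin (b + 1) → ℝ) (h n : ℕ) : ℝ := 1 - avoid ρ h n

theorem reach_nonneg {b : ℕ} {ρ : Fin (b + 1) → ℝ} (h0 : ∀ j, 0 ≤ ρ j) (hs : ∑ j, ρ j = 1)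
    (h n : ℕ) : 0 ≤ reach ρ h n := sub_nonneg.2 (avoid_mem_Icc h0 hs h n).2

theorem reach_le_one {b : ℕ} {ρ : Fin (b + 1) → ℝ} (h0 : ∀ j, 0 ≤ ρ j) (hs : ∑ j, ρ j = 1)
    (h n : ℕ) : reach ρ h n ≤ 1 := sub_le_self _ (avoid_mem_Icc h0 hs h n).1

theorem reach_zero_right {b : ℕ} {ρ : Fin (b + 1) → ℝ} (hs : ∑ j, ρ j = 1) (h : ℕ) :
    reach ρ h 0 = 0 := by rw [reach, avoid_zero_right hs, sub_self]

theorem reach_antitone {b : ℕ} {ρ : Fin (b + 1) → ℝ} (h0 : ∀ j, 0 ≤ ρ j) (hs : ∑ j, ρ j = 1)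
    (n : ℕ) : Antitone fun h => reach ρ h n :=
  fun _ _ h => sub_le_sub_left (avoid_monotone h0 hs n h) 1

/-! ### Subcritical case: an exponential supersolution -/

/-- The hypothesis `hyX` says that `y ^ h * X ^ n` is a supersolution of the linear recursion left
after dropping the negative quadratic term. -/
theorem reach_le_pow_mul_pow {b : ℕ} {ρ : Fin (b + 1) → ℝ} (h0 : ∀ j, 0 ≤ ρ j)
    (hs : ∑ j, ρ j = 1) {y X : ℝ} (hy : 0 < y) (hX : 1 ≤ X)
    (hyX : (b - ∑ j, ρ j * (j : ℕ)) + b / X ≤ y) (hm : 0 ≤ b - ∑ j, ρ j * (j : ℕ)) (h n : ℕ) :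
    reach ρ h n ≤ y ^ h * X ^ n := by
  have hX0 : 0 < X := by linarith
  induction h generalizing n with
  | zero =>
    rw [pow_zero, one_mul]
    exact (reach_le_one h0 hs 0 n).trans (one_le_pow₀ hX)
  | succ h ih =>
    rcases n with _ | n
    · rw [reach_zero_right hs]
      positivity
    · have h1 := one_sub_avoid_succ_le h0 hs h (n + 1)
      have h2 : 0 ≤ (∑ j : Fin (b + 1), ρ j * if (j : ℕ) + 2 ≤ b then 1 else 0) *
          (1 - avoid ρ h (n + 1)) ^ 2 :=
        mul_nonneg (Finset.sum_nonneg fun j _ => mul_nonneg (h0 j) (by split_ifs <;> norm_num))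
          (sq_nonneg _)
      rw [Nat.add_sub_cancel] at h1
      calc reach ρ (h + 1) (n + 1)
          ≤ (b - ∑ j, ρ j * (j : ℕ)) * reach ρ h (n + 1) + b * reach ρ h n := by
            simp only [reach] at *
            linarith
        _ ≤ (b - ∑ j, ρ j * (j : ℕ)) * (y ^ h * X ^ (n + 1)) + b * (y ^ h * X ^ n) :=
            add_le_add (mul_le_mul_of_nonneg_left (ih _) hm)
              (mul_le_mul_of_nonneg_left (ih _) (Nat.cast_nonneg b))
        _ = ((b - ∑ j, ρ j * (j : ℕ)) + b / X) * (y ^ h * X ^ (n + 1)) := by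
            field_simp
            ring
        _ ≤ y * (y ^ h * X ^ (n + 1)) := mul_le_mul_of_nonneg_right hyX (by positivity)
        _ = y ^ (h + 1) * X ^ (n + 1) := by ring

/-! ### Critical case: iterated square roots -/

section Critical

variable {b : ℕ} {ρ : Fin (b + 1) → ℝ}

/-- Sum the recursion over the heights from `N` to `2 * N`. By monotonicity in the height, each step
gains at most `b * reach ρ N n` and loses at least `c * reach ρ (2 * N) (n + 1) ^ 2`; the quantity
starts at most 1 and stays nonnegative. -/
theorem mul_reach_sq_le (h0 : ∀ j, 0 ≤ ρ j) (hs : ∑ j, ρ j = 1)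
    (hm : ∑ j, ρ j * (j : ℕ) = (b : ℝ) - 1) (N n : ℕ) :
    (∑ j : Fin (b + 1), ρ j * if (j : ℕ) + 2 ≤ b then 1 else 0) *
      (N * reach ρ (2 * N) (n + 1) ^ 2) ≤ 1 + N * (b * reach ρ N n) := by
  set c := ∑ j : Fin (b + 1), ρ j * if (j : ℕ) + 2 ≤ b then (1 : ℝ) else 0 with hc
  have hc0 : 0 ≤ c :=
    Finset.sum_nonneg fun j _ => mul_nonneg (h0 j) (by split_ifs <;> norm_num)
  have key : ∀ i ≤ N, reach ρ (N + i) (n + 1) ≤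
      1 + i * (b * reach ρ N n - c * reach ρ (2 * N) (n + 1) ^ 2) := by
    intro i hi
    induction i with
    | zero => simpa using reach_le_one h0 hs N (n + 1)
    | succ i ih =>
      have h1 := one_sub_avoid_succ_le h0 hs (N + i) (n + 1)
      rw [hm, Nat.add_sub_cancel, ← hc] at h1
      have h2 : reach ρ (N + i) n ≤ reach ρ N n := reach_antitone h0 hs n (by omega)
      have h3 : reach ρ (2 * N) (n + 1) ≤ reach ρ (N + i) (n + 1) :=
        reach_antitone h0 hs (n + 1) (by omega)
      have h4 := mul_le_mul_of_nonneg_left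
        (pow_le_pow_left₀ (reach_nonneg h0 hs _ _) h3 2) hc0
      have h5 := mul_le_mul_of_nonneg_left h2 (Nat.cast_nonneg (α := ℝ) b)
      have h6 := ih (by omega)
      push_cast
      rw [← add_assoc]
      simp only [reach] at *
      linarith
  have := key N le_rfl
  have := reach_nonneg h0 hs (N + N) (n + 1)
  linarith

/-- Doubling the height turns a bound of order `x ^ 2` at `n` into one of order `x` at `n + 1`,
hence the induction passes from `x` to `x ^ 2`. The hypothesis `hx` lets the additive 1 of
`mul_reach_sq_le` be absorbed, and `hK` makes the constant `K` reproduce itself. -/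
theorem reach_two_pow_mul_le (h0 : ∀ j, 0 ≤ ρ j) (hs : ∑ j, ρ j = 1)
    (hm : ∑ j, ρ j * (j : ℕ) = (b : ℝ) - 1) {K : ℝ} (hK1 : 1 ≤ K)
    (hK : 1 + b ≤ (∑ j : Fin (b + 1), ρ j * if (j : ℕ) + 2 ≤ b then 1 else 0) * K)
    {N : ℕ} (hN : 0 < N) (n : ℕ) {x : ℝ} (hx0 : 0 ≤ x) (hx1 : x ≤ 1)
    (hx : (1 : ℝ) ≤ N * x ^ 2 ^ n) :
    reach ρ (2 ^ n * N) n ≤ K * x := by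
  induction n generalizing x with
  | zero =>
    rw [reach_zero_right hs]
    positivity
  | succ n ih =>
    have hx2 : x ^ 2 ≤ 1 := pow_le_one₀ hx0 hx1
    have h1 := ih (x := x ^ 2) (by positivity) hx2 (by rw [← pow_mul, ← pow_succ']; exact hx)
    have h2 := mul_reach_sq_le h0 hs hm (2 ^ n * N) n
    rw [← mul_assoc 2, ← pow_succ'] at h2
    set c := ∑ j : Fin (b + 1), ρ j * if (j : ℕ) + 2 ≤ b then (1 : ℝ) else 0 with hc
    have hb : (0 : ℝ) ≤ b := Nat.cast_nonneg b
    have hc0 : 0 < c := by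
      by_contra hneg
      nlinarith
    have hN1 : (1 : ℝ) ≤ N := by exact_mod_cast hN
    set M : ℝ := ((2 ^ n * N : ℕ) : ℝ) with hM
    have hMN : (N : ℝ) ≤ M := by
      rw [hM]
      exact_mod_cast Nat.le_mul_of_pos_left N (by positivity)
    have hM0 : 0 < M := by linarith
    have hMx : 1 ≤ M * x ^ 2 := by
      have h3 : x ^ 2 ^ (n + 1) ≤ x ^ 2 :=
        pow_le_pow_of_le_one hx0 hx1 (Nat.le_self_pow (by omega) 2)
      exact hx.trans (mul_le_mul hMN h3 (by positivity) hM0.le)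
    set r := reach ρ (2 ^ (n + 1) * N) (n + 1) with hr
    have h4 : c * r ^ 2 ≤ (1 + b * K) * x ^ 2 := by
      refine le_of_mul_le_mul_left ?_ hM0
      calc M * (c * r ^ 2) = c * (M * r ^ 2) := by ring
        _ ≤ 1 + M * (b * reach ρ (2 ^ n * N) n) := h2
        _ ≤ M * x ^ 2 + M * (b * (K * x ^ 2)) := by gcongr
        _ = M * ((1 + b * K) * x ^ 2) := by ring
    have h5 : c * r ^ 2 ≤ c * (K * x) ^ 2 := by
      refine h4.trans ?_
      have : 1 + b * K ≤ c * K * K := by nlinarith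
      calc (1 + b * K) * x ^ 2 ≤ c * K * K * x ^ 2 := by gcongr
        _ = c * (K * x) ^ 2 := by ring
    exact le_of_sq_le_sq (le_of_mul_le_mul_left h5 hc0) (by positivity)

/-- The vertices of cost zero form a critical branching process with bounded offspring, whose
survival probability to height `h` is at least of order 1/h. -/
theorem inv_le_reach_one (hb : 0 < b) (h0 : ∀ j, 0 ≤ ρ j) (hs : ∑ j, ρ j = 1)
    (hm : ∑ j, ρ j * (j : ℕ) = (b : ℝ) - 1) (h : ℕ) :
    1 / (2 * (h + 1)) ≤ b ^ 2 * reach ρ h 1 := by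
  have hb1 : (1 : ℝ) ≤ b := by exact_mod_cast hb
  have hb2 : (1 : ℝ) ≤ b ^ 2 := one_le_pow₀ hb1
  induction h with
  | zero =>
    have : reach ρ 0 1 = 1 := by simp [reach, avoid]
    rw [this]
    norm_num
    linarith
  | succ h ih =>
    set s : ℝ := 1 / (2 * (h + 1)) with hs_def
    set t : ℝ := s / b ^ 2 with ht_def
    have hs0 : 0 < s := by positivity
    have ht0 : 0 < t := by positivity
    have hbt : b ^ 2 * t = s := by
      rw [ht_def]
      field_simp
    have htr : t ≤ reach ρ h 1 := by
      rw [ht_def, div_le_iff₀' (by linarith)]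
      exact ih
    have ht1 : t ≤ 1 := htr.trans (reach_le_one h0 hs h 1)
    -- Since `t - b ^ 2 * t ^ 2` is not monotone in `t`, the lower bound `t` replaces `reach ρ h 1`
    -- before the product is expanded.
    have hstep : t - b ^ 2 * t ^ 2 ≤ reach ρ (h + 1) 1 := by
      rw [reach, one_sub_avoid_succ hs]
      calc t - b ^ 2 * t ^ 2
          = ∑ j : Fin (b + 1), (b * t * ρ j - ρ j * (j : ℕ) * t - b ^ 2 * t ^ 2 * ρ j) := by
            simp only [Finset.sum_sub_distrib, ← Finset.mul_sum, ← Finset.sum_mul, hs, hm]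
            ring
        _ ≤ _ := by
            refine Finset.sum_le_sum fun j _ => ?_
            have h1 := mul_le_mul_of_nonneg_left (pow_mul_pow_le_one_sub ht1 le_rfl ht0.le
              (Nat.lt_succ_iff.1 j.2)) (h0 j)
            have h2 : (1 - reach ρ h 1) ^ (b - (j : ℕ)) ≤ (1 - t) ^ (b - (j : ℕ)) :=
              pow_le_pow_left₀ (sub_nonneg.2 (reach_le_one h0 hs h 1)) (by linarith) _
            have h3 := mul_le_mul_of_nonneg_left h2 (h0 j)
            rw [← reach, Nat.sub_self, avoid_zero_right hs]
            simp only [sub_self, sub_zero, one_pow, mul_one, mul_zero, add_zero] at h1 ⊢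
            linarith
    calc 1 / (2 * (((h + 1 : ℕ) : ℝ) + 1)) ≤ s - s ^ 2 := by
          have hm0 : (0 : ℝ) ≤ h := Nat.cast_nonneg h
          rw [hs_def, ← sub_nonneg]
          have : 1 / (2 * ((h : ℝ) + 1)) - (1 / (2 * ((h : ℝ) + 1))) ^ 2 -
              1 / (2 * (((h + 1 : ℕ) : ℝ) + 1)) = h / (4 * (h + 1) ^ 2 * (h + 2)) := by
            push_cast
            field_simp
            ring
          rw [this]
          positivity
      _ = b ^ 2 * (t - b ^ 2 * t ^ 2) := by rw [← hbt]; ring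
      _ ≤ _ := mul_le_mul_of_nonneg_left hstep (by linarith)

theorem le_mul_reach (hb : 2 ≤ b) (h0 : ∀ j, 0 ≤ ρ j) (hs : ∑ j, ρ j = 1)
    (hm : ∑ j, ρ j * (j : ℕ) = (b : ℝ) - 1) (h n : ℕ) {x : ℝ}
    (hx : x ^ 2 ^ n ≤ b ^ 2 * reach ρ h 1) : x ≤ b ^ 2 * reach ρ h (n + 1) := by
  induction n generalizing x with
  | zero => simpa using hx
  | succ n ih =>
    have h1 := ih (x := x ^ 2) (by rw [← pow_mul, ← pow_succ']; exact hx)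
    have h2 := le_one_sub_avoid_succ h0 hs h (n + 2)
    have h3 : reach ρ (h + 1) (n + 2) ≤ reach ρ h (n + 2) := reach_antitone h0 hs _ h.le_succ
    have h4 := reach_nonneg h0 hs h (n + 1)
    have hb' : (2 : ℝ) ≤ b := by exact_mod_cast hb
    rw [hm, show n + 2 - 1 = n + 1 by omega] at h2
    -- As `reach` decreases with the height, the term `reach ρ h (n + 2)` cancels; the remaining
    -- coefficient `b - 1` is at least 1.
    have h5 : reach ρ h (n + 1) ≤ b ^ 2 * reach ρ h (n + 2) ^ 2 := by
      simp only [reach] at h2 h3 h4 ⊢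
      nlinarith
    refine le_of_sq_le_sq (h1.trans ?_) (mul_nonneg (by positivity) (reach_nonneg h0 hs _ _))
    calc _ ≤ (b : ℝ) ^ 2 * (b ^ 2 * reach ρ h (n + 2) ^ 2) := by gcongr
      _ = _ := by ring

end Critical

/-! ### Passage to probabilities and choice of constants -/

theorem tendsto_measure_of_unreached {b : ℕ} {Ω : Type*} [MeasurableSpace Ω] {P : Measure Ω}
    [IsProbabilityMeasure P] {R : List (Fin b) → Ω → Fin (b + 1)} (hR : ∀ v, Measurable (R v))
    (hind : iIndepFun R P) {μ : Measure (Fin (b + 1))} (hμ : ∀ v, P.map (R v) = μ)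
    {H L : ℕ → ℕ} (hH : Tendsto (fun n => reach (fun j => μ.real {j}) (H n) n) atTop (𝓝 0))
    (hL : Tendsto (fun n => avoid (fun j => μ.real {j}) (L n) n) atTop (𝓝 0))
    {A : ℕ → Set Ω} (hA : ∀ᶠ n in atTop, ∀ ω, Unreached (fun v => R v ω) (H n) n [] →
      ¬ Unreached (fun v => R v ω) (L n) n [] → ω ∈ A n) :
    Tendsto (fun n => P (A n)) atTop (𝓝 1) := by
  have hle : ∀ᶠ n in atTop, 1 - reach (fun j => μ.real {j}) (H n) n -
      avoid (fun j => μ.real {j}) (L n) n ≤ P.real (A n) := by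
    filter_upwards [hA] with n hn
    rw [reach, sub_sub_cancel, ← measureReal_unreached hR hind hμ (H n) n [],
      ← measureReal_unreached hR hind hμ (L n) n [], sub_le_iff_le_add]
    refine (measureReal_mono (s₂ := A n ∪ {ω | Unreached (fun w => R w ω) (L n) n []})
      fun ω hω => ?_).trans (measureReal_union_le _ _)
    by_cases h : Unreached (fun w => R w ω) (L n) n []
    · exact Or.inr h
    · exact Or.inl (hn ω hω h)
  have hlim : Tendsto (fun n => P.real (A n)) atTop (𝓝 1) := by
    refine tendsto_of_tendsto_of_tendsto_of_le_of_le' ?_ tendsto_const_nhds hle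
      (Eventually.of_forall fun n => measureReal_le_one)
    simpa using (tendsto_const_nhds (x := (1 : ℝ))).sub hH |>.sub hL
  simpa [ofReal_measureReal] using ENNReal.tendsto_ofReal hlim

theorem exists_maxDepth_eq {b n H : ℕ} {r : Config b} (hH : Unreached r H n []) :
    ∃ d : ℕ, maxDepth r n = d ∧ d ≤ H ∧
      ∀ w, cost r [] w < n → w.length + 1 ≤ d := by
  have hle := maxDepth_le hH
  obtain ⟨d, hd⟩ := ENat.ne_top_iff_exists.1 (ne_top_of_le_ne_top (ENat.natCast_ne_top H) hle)
  refine ⟨d, hd.symm, ?_, fun w hw => ?_⟩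
  · rw [← hd] at hle
    exact_mod_cast hle
  · have := lt_maxDepth hH hw
    rw [← hd] at this
    exact_mod_cast this

/-- Otherwise the rotor is almost surely at least `b - 1`; having mean `b - 1`, it would be
constant. -/
theorem sum_ite_pos {b : ℕ} (hb : 2 ≤ b) {ρ : Fin (b + 1) → ℝ} (h0 : ∀ j, 0 ≤ ρ j)
    (hs : ∑ j, ρ j = 1) (hm : ∑ j, ρ j * (j : ℕ) = (b : ℝ) - 1) (hρ : ∀ k, ∃ j ≠ k, ρ j ≠ 0) :
    0 < ∑ j : Fin (b + 1), ρ j * if (j : ℕ) + 2 ≤ b then 1 else 0 := by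
  have hnn : ∀ j : Fin (b + 1), 0 ≤ ρ j * if (j : ℕ) + 2 ≤ b then (1 : ℝ) else 0 :=
    fun j => mul_nonneg (h0 j) (by split_ifs <;> norm_num)
  refine (Finset.sum_nonneg fun j _ => hnn j).lt_of_ne' fun hzero => ?_
  have hz := (Finset.sum_eq_zero_iff_of_nonneg fun j _ => hnn j).1 hzero
  have hz' : ∀ j : Fin (b + 1), ρ j ≠ 0 → b ≤ (j : ℕ) + 1 := fun j hj => by
    by_contra hlt
    have := hz j (Finset.mem_univ j)
    rw [if_pos (by omega), mul_one] at this
    exact hj this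
  have hnn' : ∀ j : Fin (b + 1), 0 ≤ ρ j * ((j : ℕ) - ((b : ℝ) - 1)) := fun j => by
    by_cases hj : ρ j = 0
    · simp [hj]
    · have : (b : ℝ) ≤ (j : ℕ) + 1 := by exact_mod_cast hz' j hj
      exact mul_nonneg (h0 j) (by linarith)
  have hsum : ∑ j, ρ j * ((j : ℕ) - ((b : ℝ) - 1)) = 0 := by
    simp only [mul_sub, Finset.sum_sub_distrib, ← Finset.sum_mul, hs, hm]
    ring
  obtain ⟨j, hjk, hj⟩ := hρ ⟨b - 1, by omega⟩
  have := (Finset.sum_eq_zero_iff_of_nonneg fun j _ => hnn' j).1 hsum j (Finset.mem_univ j)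
  rcases mul_eq_zero.1 this with h | h
  · exact hj h
  · refine hjk (Fin.ext ?_)
    have h' : ((j : ℕ) : ℝ) + 1 = b := by linarith
    have : (j : ℕ) + 1 = b := by exact_mod_cast h'
    change (j : ℕ) = b - 1
    omega

theorem tendsto_reach_upper {b : ℕ} {ρ : Fin (b + 1) → ℝ} (h0 : ∀ j, 0 ≤ ρ j)
    (hs : ∑ j, ρ j = 1) (hm : ∑ j, ρ j * (j : ℕ) = (b : ℝ) - 1)
    (hc : 0 < ∑ j : Fin (b + 1), ρ j * if (j : ℕ) + 2 ≤ b then 1 else 0) :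
    Tendsto (fun n => reach ρ (2 ^ n * ⌈Real.exp (4 ^ n)⌉₊) n) atTop (𝓝 0) := by
  set c := ∑ j : Fin (b + 1), ρ j * if (j : ℕ) + 2 ≤ b then (1 : ℝ) else 0 with hc_def
  set K := max 1 ((1 + b) / c) with hK_def
  have hK : 1 + b ≤ c * K := (div_le_iff₀' hc).1 (le_max_right _ _)
  -- The choice `x = exp (-2 ^ n)` gives `x ^ 2 ^ n = exp (-4 ^ n)`, which explains the factor `exp
  -- (4 ^ n)` in the height.
  have hbound : ∀ n, reach ρ (2 ^ n * ⌈Real.exp (4 ^ n)⌉₊) n ≤ K * Real.exp (-2 ^ n) := fun n => by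
    refine reach_two_pow_mul_le h0 hs hm (le_max_left _ _) hK (Nat.ceil_pos.2 (Real.exp_pos _)) n
      (Real.exp_pos _).le (Real.exp_le_one_iff.2 (neg_nonpos.2 (by positivity))) ?_
    rw [← Real.exp_nat_mul]
    have : ((2 ^ n : ℕ) : ℝ) * -2 ^ n = -4 ^ n := by
      push_cast
      rw [mul_neg, ← mul_pow]
      norm_num
    rw [this]
    calc (1 : ℝ) = Real.exp (4 ^ n) * Real.exp (-4 ^ n) := by rw [← Real.exp_add]; simp
      _ ≤ _ := mul_le_mul_of_nonneg_right (Nat.le_ceil _) (Real.exp_pos _).le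
  refine squeeze_zero (fun n => reach_nonneg h0 hs _ _) hbound ?_
  have h1 : Tendsto (fun n : ℕ => Real.exp (-2 ^ n)) atTop (𝓝 0) :=
    Real.tendsto_exp_neg_atTop_nhds_zero.comp (tendsto_pow_atTop_atTop_of_one_lt one_lt_two)
  simpa using h1.const_mul K

theorem two_pow_mul_ceil_lt {n : ℕ} (hn : 1 ≤ n) :
    ((2 ^ n * ⌈Real.exp (4 ^ n)⌉₊ : ℕ) : ℝ) < Real.exp (Real.exp (3 * n)) := by
  have he : (2 : ℝ) < Real.exp 1 := lt_trans (by norm_num) Real.exp_one_gt_d9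
  have h4 : (1 : ℝ) ≤ Real.exp (4 ^ n) := Real.one_le_exp (by positivity)
  have hceil : (⌈Real.exp (4 ^ n)⌉₊ : ℝ) ≤ Real.exp 1 * Real.exp (4 ^ n) := by
    have := (Nat.ceil_lt_add_one (Real.exp_pos (4 ^ n)).le).le
    nlinarith
  have h2 : (2 : ℝ) ^ n ≤ Real.exp n := by
    rw [← Real.exp_one_pow]
    exact pow_le_pow_left₀ (by norm_num) he.le n
  push_cast
  calc (2 : ℝ) ^ n * ⌈Real.exp (4 ^ n)⌉₊ ≤ Real.exp n * (Real.exp 1 * Real.exp (4 ^ n)) := by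
        gcongr
    _ = Real.exp (n + (1 + 4 ^ n)) := by rw [Real.exp_add, Real.exp_add]
    _ < Real.exp (Real.exp (3 * n)) := by
        rw [Real.exp_lt_exp]
        have h8 : (8 : ℝ) ^ n < Real.exp (3 * n) := by
          have : Real.exp (3 * n) = (Real.exp 1 ^ 3) ^ n := by
            rw [← pow_mul, Real.exp_one_pow]
            push_cast
            rfl
          rw [this]
          refine pow_lt_pow_left₀ ?_ (by norm_num) (by omega)
          calc (8 : ℝ) = 2 ^ 3 := by norm_num
            _ < _ := pow_lt_pow_left₀ he (by norm_num) (by norm_num)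
        have h9 : ((n + (1 + 4 ^ n) : ℕ) : ℝ) ≤ ((8 ^ n : ℕ) : ℝ) := by
          rw [Nat.cast_le]
          have ha : n + 1 ≤ 2 ^ n := Nat.lt_two_pow_self
          have hb : 2 ≤ 2 ^ n := by simpa using Nat.pow_le_pow_right (n := 2) (by norm_num) hn
          have h1 : 4 ^ n = 2 ^ n * 2 ^ n := by rw [← mul_pow]; norm_num
          have h2 : 8 ^ n = 2 ^ n * (2 ^ n * 2 ^ n) := by rw [← mul_pow, ← mul_pow]; norm_num
          rw [h1, h2]
          nlinarith [Nat.mul_le_mul_right (2 ^ n * 2 ^ n) hb, Nat.mul_le_mul_left (2 ^ n) hb]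
        push_cast at h9
        linarith

theorem tendsto_avoid_lower {b : ℕ} (hb : 2 ≤ b) {ρ : Fin (b + 1) → ℝ} (h0 : ∀ j, 0 ≤ ρ j)
    (hs : ∑ j, ρ j = 1) (hm : ∑ j, ρ j * (j : ℕ) = (b : ℝ) - 1) :
    Tendsto (fun n : ℕ => avoid ρ ⌈Real.exp (Real.exp (Real.log 2 / 4 * n))⌉₊ n) atTop (𝓝 0) := by
  have hb2 : (0 : ℝ) < b ^ 2 := by positivity
  -- With `E = exp (2 ^ m)` and height at most `E + 1`, the bound 1/(2(h+1)) is at least `1 / E ^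
  -- 3`, whose root of order `2 ^ m` is `exp (-3)`.
  set u := Real.exp (-3) / b ^ 2 with hu
  have hu0 : 0 < u := by positivity
  have hreach : ∀ n m : ℕ, n ≤ 4 * m →
      u ≤ reach ρ ⌈Real.exp (Real.exp (Real.log 2 / 4 * n))⌉₊ (m + 1) := by
    intro n m hnm
    rw [hu, div_le_iff₀' hb2]
    refine le_mul_reach hb h0 hs hm _ m (le_trans ?_ (inv_le_reach_one (by omega) h0 hs hm _))
    have h1 : Real.exp (Real.log 2 / 4 * n) ≤ 2 ^ m := by
      rw [← Real.exp_log (zero_lt_two (α := ℝ)), ← Real.exp_nat_mul, Real.exp_le_exp,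
        Real.exp_log zero_lt_two]
      have : (n : ℝ) ≤ 4 * m := by exact_mod_cast hnm
      nlinarith [Real.log_pos one_lt_two]
    have h2 : (1 : ℝ) ≤ 2 ^ m := one_le_pow₀ one_le_two
    set E := Real.exp (2 ^ m) with hE
    have hEpos : 0 < E := Real.exp_pos _
    have hE2 : 2 < E := lt_of_lt_of_le (lt_trans (by norm_num) Real.exp_one_gt_d9)
      (Real.exp_le_exp.2 h2)
    have h3 : (⌈Real.exp (Real.exp (Real.log 2 / 4 * n))⌉₊ : ℝ) ≤ E + 1 :=
      (Nat.ceil_lt_add_one (Real.exp_pos _).le).le.trans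
        (by gcongr; exact Real.exp_le_exp.2 h1)
    have h4 : Real.exp (-3) ^ 2 ^ m = 1 / E ^ 3 := by
      rw [← Real.exp_nat_mul, hE, ← Real.exp_nat_mul, one_div, ← Real.exp_neg]
      congr 1
      push_cast
      ring
    rw [h4]
    apply one_div_le_one_div_of_le (by positivity)
    nlinarith [mul_pos hEpos hEpos]
  have hu1 : u ≤ 1 := (hreach 0 0 (by simp)).trans (reach_le_one h0 hs _ _)
  have hbound : ∀ᶠ n : ℕ in atTop,
      avoid ρ ⌈Real.exp (Real.exp (Real.log 2 / 4 * n))⌉₊ n ≤ (1 - u) ^ (n / 4) := by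
    filter_upwards [eventually_ge_atTop 8] with n hn
    -- Split the budget: `m + 1` units reach the height with probability at least `u`, and the other
    -- `j` units open `b ^ j` independent attempts.
    obtain ⟨m, j, hmn, hnm, hj⟩ : ∃ m j, n = m + 1 + j ∧ n ≤ 4 * m ∧ n / 4 ≤ j :=
      ⟨n / 2 - 1, n - n / 2, by omega, by omega, by omega⟩
    have h1 := hreach n m hnm
    rw [reach] at h1
    calc avoid ρ ⌈Real.exp (Real.exp (Real.log 2 / 4 * n))⌉₊ n
        ≤ avoid ρ (⌈Real.exp (Real.exp (Real.log 2 / 4 * n))⌉₊ + j) (m + 1 + j) := by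
          rw [← hmn]
          exact avoid_monotone h0 hs n (Nat.le_add_right _ _)
      _ ≤ avoid ρ ⌈Real.exp (Real.exp (Real.log 2 / 4 * n))⌉₊ (m + 1) ^ b ^ j :=
          avoid_add_add_le_pow h0 hs _ _ _
      _ ≤ (1 - u) ^ b ^ j := pow_le_pow_left₀ (avoid_mem_Icc h0 hs _ _).1 (by linarith) _
      _ ≤ (1 - u) ^ (n / 4) := pow_le_pow_of_le_one (by linarith) (by linarith)
          (hj.trans (Nat.lt_pow_self (by omega)).le)
  refine squeeze_zero' (Eventually.of_forall fun n => (avoid_mem_Icc h0 hs _ _).1) hbound ?_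
  exact (tendsto_pow_atTop_nhds_zero_of_lt_one (by linarith) (by linarith)).comp
    (Nat.tendsto_div_const_atTop (by norm_num))

theorem exists_tendsto_reach_mul {b : ℕ} (hb : 0 < b) {ρ : Fin (b + 1) → ℝ} (h0 : ∀ j, 0 ≤ ρ j)
    (hs : ∑ j, ρ j = 1) (hm : (b : ℝ) - 1 < ∑ j, ρ j * (j : ℕ)) :
    ∃ L : ℕ, Tendsto (fun n => reach ρ (L * n) n) atTop (𝓝 0) := by
  set m := (b : ℝ) - ∑ j, ρ j * (j : ℕ) with hm_def
  have hb1 : (1 : ℝ) ≤ b := by exact_mod_cast hb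
  have hm1 : m < 1 := by linarith
  have hm0 : 0 ≤ m := by
    have : ∑ j, ρ j * ((j : ℕ) : ℝ) ≤ ∑ j, ρ j * b := Finset.sum_le_sum fun j _ =>
      mul_le_mul_of_nonneg_left (by exact_mod_cast Nat.lt_succ_iff.1 j.2) (h0 j)
    rw [← Finset.sum_mul, hs, one_mul] at this
    linarith
  -- This makes `m + b / X` equal to `(1 + m) / 2 < 1`.
  set X := 2 * b / (1 - m) with hX
  have hX1 : 1 ≤ X := (one_le_div (by linarith)).2 (by linarith)
  have hX0 : 0 < X := by linarith
  obtain ⟨L, hL⟩ := exists_pow_lt_of_lt_one (show 0 < 1 / (2 * X) by positivity)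
    (show (1 + m) / 2 < 1 by linarith)
  refine ⟨L, squeeze_zero (g := fun n => (1 / 2 : ℝ) ^ n) (fun n => reach_nonneg h0 hs _ _)
    (fun n => ?_) (tendsto_pow_atTop_nhds_zero_of_lt_one (by norm_num) (by norm_num))⟩
  refine (reach_le_pow_mul_pow h0 hs (y := (1 + m) / 2) (X := X) (by linarith) hX1 ?_ hm0
    (L * n) n).trans ?_
  · have : (b : ℝ) / X = (1 - m) / 2 := by
      rw [hX]
      have : 1 - m ≠ 0 := by linarith
      field_simp
    rw [this, ← hm_def]
    linarith
  · rw [pow_mul, ← mul_pow]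
    refine pow_le_pow_left₀ (mul_nonneg (pow_nonneg (by linarith) _) hX0.le) ?_ n
    rw [lt_div_iff₀ (by positivity)] at hL
    linarith

end RotorWalk

theorem theorem7 (b : ℕ) (hb : 2 ≤ b)
    (μ : Measure (Fin (b + 1))) [IsProbabilityMeasure μ]
    (hμ : ∀ k : Fin (b + 1), μ ≠ Measure.dirac k) :
    ∃ c C : ℝ, 0 < c ∧ 0 < C ∧
      ∀ (Ω : Type*) [MeasurableSpace Ω] (P : Measure Ω) [IsProbabilityMeasure P]
        (R : List (Fin b) → Ω → Fin (b + 1)),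
        (∀ v, Measurable (R v)) → iIndepFun R P → (∀ v, P.map (R v) = μ) →
        ((∫ k, ((k : ℕ) : ℝ) ∂μ = (b : ℝ) - 1 →
            Tendsto (fun n : ℕ => P {ω | ∃ d : ℕ,
                RotorWalk.maxDepth (fun v => R v ω) n = (d : ℕ∞) ∧
                Real.exp (Real.exp (c * n)) < d ∧ (d : ℝ) < Real.exp (Real.exp (C * n))})
              atTop (𝓝 1)) ∧
          ((b : ℝ) - 1 < ∫ k, ((k : ℕ) : ℝ) ∂μ →
            Tendsto (fun n : ℕ => P {ω | ∃ d : ℕ,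
                RotorWalk.maxDepth (fun v => R v ω) n = (d : ℕ∞) ∧
                n ≤ d ∧ (d : ℝ) < C * n})
              atTop (𝓝 1))) := by
  classical
  have h0 : ∀ j : Fin (b + 1), 0 ≤ μ.real {j} := fun j => measureReal_nonneg
  have hs : ∑ j, μ.real {j} = 1 := by
    rw [sum_measureReal_singleton, Finset.coe_univ, probReal_univ]
  have hint : ∫ k, ((k : ℕ) : ℝ) ∂μ = ∑ j, μ.real {j} * (j : ℕ) := by
    rw [integral_fintype .of_finite]
    simp
  have hρ : ∀ k, ∃ j ≠ k, μ.real {j} ≠ 0 := by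
    intro k
    by_contra! H
    have h1 : μ {k}ᶜ = 0 := by
      rw [← Set.biUnion_of_singleton {k}ᶜ, measure_biUnion_null_iff (Set.to_countable _)]
      exact fun j hj => (measureReal_eq_zero_iff).1 (H j hj)
    refine hμ k (Measure.ext_of_singleton fun j => ?_)
    by_cases hj : j = k
    · rw [hj, (prob_compl_eq_zero_iff MeasurableSet.of_discrete).1 h1]
      simp
    · rw [(measureReal_eq_zero_iff).1 (H j hj)]
      simp [Ne.symm hj]
  -- The mean decides which of the two claims is not vacuous, so each case chooses its constants for
  -- one claim only.
  rcases lt_or_ge ((b : ℝ) - 1) (∫ k, ((k : ℕ) : ℝ) ∂μ) with hm | hm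
  · obtain ⟨L, hL⟩ := RotorWalk.exists_tendsto_reach_mul (by omega) h0 hs (hint ▸ hm)
    refine ⟨1, L + 1, one_pos, by positivity, fun Ω _ P _ R hR hind hmap =>
      ⟨fun h => absurd h hm.ne', fun _ => ?_⟩⟩
    -- The lower bound is deterministic here, so the second event is made trivial by height 0.
    refine RotorWalk.tendsto_measure_of_unreached hR hind hmap hL (L := fun _ => 0) ?_ ?_
    · refine tendsto_const_nhds.congr' ?_
      filter_upwards [eventually_gt_atTop 0] with n hn
      simp [RotorWalk.avoid, hn.ne']
    · filter_upwards [eventually_gt_atTop 0] with n hn ω hω _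
      obtain ⟨d, hd, hdL, hw⟩ := RotorWalk.exists_maxDepth_eq hω
      refine ⟨d, hd, ?_, ?_⟩
      -- Any word of length `n - 1` has cost below `n` and level `n`.
      · have := hw (List.replicate (n - 1) ⟨0, by omega⟩)
          ((RotorWalk.cost_le_length _ _).trans_lt (by simp; omega))
        simp at this
        omega
      · have h1 : (d : ℝ) ≤ L * n := by exact_mod_cast hdL
        have h2 : (0 : ℝ) < n := by exact_mod_cast hn
        linarith
  · refine ⟨Real.log 2 / 4, 3, div_pos (Real.log_pos one_lt_two) (by norm_num), by norm_num,
      fun Ω _ P _ R hR hind hmap => ⟨fun h => ?_, fun h => absurd h hm.not_gt⟩⟩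
    rw [hint] at h
    refine RotorWalk.tendsto_measure_of_unreached hR hind hmap
      (RotorWalk.tendsto_reach_upper h0 hs h (RotorWalk.sum_ite_pos hb h0 hs h hρ))
      (RotorWalk.tendsto_avoid_lower hb h0 hs h) ?_
    filter_upwards [eventually_ge_atTop 1] with n hn ω hω hω'
    obtain ⟨d, hd, hdL, hw⟩ := RotorWalk.exists_maxDepth_eq hω
    simp only [RotorWalk.Unreached, not_forall, not_le] at hω'
    obtain ⟨u, hu, hcost⟩ := hω'
    refine ⟨d, hd, ?_, (Nat.cast_le.2 hdL).trans_lt (RotorWalk.two_pow_mul_ceil_lt hn)⟩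
    have h1 := hw u hcost
    rw [hu] at h1
    exact (Nat.le_ceil _).trans_lt (Nat.cast_lt.2 h1)
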